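/- For an open set $U\subseteq\mathbb C$, a weight on $U$ is a continuous, bounded, strictly positive function $v\colon U\to\mathbb R$. Let $\mathcal H_v(U)$ be the space of holomorphic functions $f\colon U\to\mathbb C$ with $\|f\|_v:=\sup_{z\in U}v(z)|f(z)|<\infty$, and let $\mathcal H_{v_o}(U)$ be the subspace, with the same norm, of those $f\in\mathcal H_v(U)$ for which $v(z)|f(z)|\to 0$ as $z$ tends to the boundary of $U$, i.e. for every $\varepsilon>0$ there is a compact $K\subseteq U$ with $v(z)|f(z)|<\varepsilon$ for all $z\in U\setminus K$. Let $\Delta$ be the open unit disc in $\mathbb C$ and let $V\subseteq\mathbb C$ be open and connected. Let $v$ be a weight on $\Delta$ that is radial ($v(\lambda z)=v(z)$ for all $z\in\Delta$ and all $\lambda\in\mathbb C$ with $|\lambda|=1$) and converges to $0$ at the boundary of $\Delta$ (for every $\varepsilon>0$ there is a compact $K\subseteq\Delta$ with $v<\varepsilon$ on $\Delta\setminus K$), and let $w$ be a weight on $V$. Let $T\colon\mathcal H_{v_o}(\Delta)\to\mathcal H_{w_o}(V)$ be a (not necessarily surjective) complex-linear isometry, i.e. $T$ is linear and $\|T(f)\|_w=\|f\|_v$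 for all $f$. Then there are a holomorphic function $\phi\colon V\to\Delta$ and a function $h_\phi\in\mathcal H_{w_o}(V)$ such that $$T(f)(z)=h_\phi(z)\,f(\phi(z))\qquad\text{for all } f\in\mathcal H_{v_o}(\Delta)\text{ and all } z\in V.$$ -/

import Mathlib

open TopologicalSpace

/-- A weight on an open set `U ⊆ ℂ`: a continuous, bounded, strictly positive real function. -/
structure Weight (U : Opens ℂ) where
  toFun : U → ℝ
  continuous_toFun : Continuous toFun
  bddAbove_range : BddAbove (Set.range toFun)
  pos : ∀ z, 0 < toFun z

instance Weight.instCoeFun (U : Opens ℂ) : CoeFun (Weight U) (fun _ => U → ℝ) :=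
  ⟨Weight.toFun⟩

/-- The open unit disc `Δ`. -/
def unitDisc : Opens ℂ := ⟨Metric.ball 0 1, Metric.isOpen_ball⟩

/-- A function on the open set `U` is holomorphic: it is the restriction to `U` of a function
on `ℂ` that is complex differentiable on `U` (its values off `U` play no role). -/
def IsHolomorphic {U : Opens ℂ} (f : U → ℂ) : Prop :=
  ∃ F : ℂ → ℂ, DifferentiableOn ℂ F U ∧ ∀ z : U, F z = f z

/-- `g(z) → 0` as `z` tends to the boundary of `U`: for every `ε > 0` there is a compact subset
of `U` outside of which `|g| < ε`. -/
def VanishesAtBoundary {U : Opens ℂ} (g : U → ℝ) : Prop :=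
  ∀ ε : ℝ, 0 < ε → ∃ K : Set U, IsCompact K ∧ ∀ z : U, z ∉ K → |g z| < ε

/-- A weight on the disc is radial: `v (c z) = v z` whenever `|c| = 1`. -/
def Weight.IsRadial (v : Weight unitDisc) : Prop :=
  ∀ (c : ℂ) (z z' : unitDisc), ‖c‖ = 1 → (z' : ℂ) = c * (z : ℂ) → v z' = v z

/-- The norm `‖f‖_v = sup_{z ∈ U} v(z) |f(z)|`; it is used only for functions for which
this supremum is finite. -/
noncomputable def weightedNorm {U : Opens ℂ} (v : Weight U) (f : U → ℂ) : ℝ :=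
  ⨆ z : U, v z * ‖f z‖

/-- The space `H_v(U)` of holomorphic functions `f` on `U` with
`sup_{z ∈ U} v(z) |f(z)| < ∞`. -/
def weightedH {U : Opens ℂ} (v : Weight U) : Submodule ℂ (U → ℂ) where
  carrier := {f | IsHolomorphic f ∧ BddAbove (Set.range fun z : U => v z * ‖f z‖)}
  zero_mem' := by
    refine ⟨⟨0, differentiableOn_const 0, fun _ => rfl⟩, 0, ?_⟩
    rintro _ ⟨z, rfl⟩
    simp
  add_mem' := by
    rintro f g ⟨⟨F, hF, hFf⟩, A, hA⟩ ⟨⟨G, hG, hGg⟩, B, hB⟩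
    refine ⟨⟨F + G, hF.add hG, fun z => by simp [hFf, hGg]⟩, A + B, ?_⟩
    rintro _ ⟨z, rfl⟩
    have h1 : v z * ‖f z‖ ≤ A := hA ⟨z, rfl⟩
    have h2 : v z * ‖g z‖ ≤ B := hB ⟨z, rfl⟩
    have h3 : v z * ‖f z + g z‖ ≤ v z * (‖f z‖ + ‖g z‖) :=
      mul_le_mul_of_nonneg_left (norm_add_le _ _) (v.pos z).le
    simp only [Pi.add_apply]
    linarith
  smul_mem' := by
    rintro c f ⟨⟨F, hF, hFf⟩, A, hA⟩
    refine ⟨⟨c • F, hF.const_smul c, fun z => by simp [hFf]⟩, ‖c‖ * A, ?_⟩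
    rintro _ ⟨z, rfl⟩
    have h1 : v z * ‖f z‖ ≤ A := hA ⟨z, rfl⟩
    have h2 := mul_le_mul_of_nonneg_left h1 (norm_nonneg c)
    simp only [Pi.smul_apply, smul_eq_mul, norm_mul]
    linarith

/-- The space `H_{v_o}(U)` of those `f ∈ H_v(U)` for which `v(z) |f(z)|` tends to `0` as `z`
tends to the boundary of `U`. -/
def weightedHo {U : Opens ℂ} (v : Weight U) : Submodule ℂ (U → ℂ) where
  carrier := {f | f ∈ weightedH v ∧ VanishesAtBoundary fun z : U => v z * ‖f z‖}
  zero_mem' := ⟨zero_mem _, fun ε hε => ⟨∅, isCompact_empty, fun z _ => by simpa using hε⟩⟩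
  add_mem' := by
    rintro f g ⟨hf, hf0⟩ ⟨hg, hg0⟩
    refine ⟨add_mem hf hg, fun ε hε => ?_⟩
    obtain ⟨K, hK, hKf⟩ := hf0 (ε / 2) (half_pos hε)
    obtain ⟨L, hL, hLg⟩ := hg0 (ε / 2) (half_pos hε)
    refine ⟨K ∪ L, hK.union hL, fun z hz => ?_⟩
    have h1 := (abs_lt.1 (hKf z fun h => hz (Or.inl h))).2
    have h2 := (abs_lt.1 (hLg z fun h => hz (Or.inr h))).2
    have h3 : v z * ‖f z + g z‖ ≤ v z * (‖f z‖ + ‖g z‖) :=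
      mul_le_mul_of_nonneg_left (norm_add_le _ _) (v.pos z).le
    have h4 : 0 ≤ v z * ‖f z + g z‖ := mul_nonneg (v.pos z).le (norm_nonneg _)
    simp only [Pi.add_apply]
    rw [abs_of_nonneg h4]
    linarith
  smul_mem' := by
    rintro c f ⟨hf, hf0⟩
    refine ⟨Submodule.smul_mem _ c hf, fun ε hε => ?_⟩
    have hc : 0 < ‖c‖ + 1 := by positivity
    obtain ⟨K, hK, hKf⟩ := hf0 (ε / (‖c‖ + 1)) (div_pos hε hc)
    refine ⟨K, hK, fun z hz => ?_⟩
    have h1 := (lt_div_iff₀ hc).1 (abs_lt.1 (hKf z hz)).2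
    have h2 : 0 ≤ v z * ‖f z‖ := mul_nonneg (v.pos z).le (norm_nonneg _)
    have h3 : v z * ‖(c • f) z‖ = v z * ‖f z‖ * ‖c‖ := by
      simp only [Pi.smul_apply, smul_eq_mul, norm_mul]
      ring
    simp only [h3]
    rw [abs_of_nonneg (mul_nonneg h2 (norm_nonneg c))]
    linarith

open Filter Topology Set

/-! Since `v` is radial and vanishes at the boundary, a whole circle of radius `0 < r < 1` consists
of strict peak points of the domain space (`exists_peak_circle`). If `p` peaks at `x` and `w |T p|`
attains its supremum at `z`, then `f ↦ w z * T f z` is contractive and attains its norm at `p`, so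
it is a multiple of evaluation at `x` (`eq_eval_of_strict_peak`). Thus `T f (ζ) = k f(ξ)` with `k ≠
0` for one `ζ` per point `ξ` of the circle.

The quotient `T(z) / T(1)` takes the value `ξ` at `ζ`, so the points `ζ` form an uncountable set,
which accumulates at a point of `V` and determines holomorphic functions on `V`. In particular
`T(z^(n+1)) T(1)^n = T(z)^(n+1)`; boundedness of the norms of `z^n` then forces `|T(z)| ≤ |T(1)|`.
Hence `φ = T(z) / T(1)` extends holomorphically to `V` and maps into the disc by the maximum
principle, and `T f = T(1) · (f ∘ φ)`, true at every `ζ`, holds on `V`. -/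

theorem IsHolomorphic.continuous {U : Opens ℂ} {f : U → ℂ} (hf : IsHolomorphic f) :
    Continuous f := by
  obtain ⟨F, hF, hFf⟩ := hf
  have := continuousOn_iff_continuous_domRestrict.1 hF.continuousOn
  exact this.congr hFf

/-! ### Weighted suprema and their attainment. -/

section Weighted

variable {U : Opens ℂ} {v : Weight U}

theorem weightedH_continuous_mul_norm {f : U → ℂ} (hf : f ∈ weightedH v) :
    Continuous fun z => v z * ‖f z‖ :=
  v.continuous_toFun.mul hf.1.continuous.norm

theorem mul_norm_le_weightedNorm {f : U → ℂ} (hf : f ∈ weightedH v) (z : U) :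
    v z * ‖f z‖ ≤ weightedNorm v f :=
  le_ciSup hf.2 z

theorem weightedNorm_nonneg (f : U → ℂ) : 0 ≤ weightedNorm v f :=
  Real.iSup_nonneg fun z => mul_nonneg (v.pos z).le (norm_nonneg _)

theorem weightedNorm_le {f : U → ℂ} {C : ℝ} (hC : 0 ≤ C) (h : ∀ z, v z * ‖f z‖ ≤ C) :
    weightedNorm v f ≤ C :=
  Real.iSup_le h hC

/-- A continuous function that vanishes at the boundary and is positive somewhere attains its
supremum. -/
theorem VanishesAtBoundary.exists_forall_le {g : U → ℝ} (hg : VanishesAtBoundary g)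
    (hc : Continuous g) {z₀ : U} (h0 : 0 < g z₀) : ∃ z, ∀ u, g u ≤ g z := by
  obtain ⟨K, hK, hgK⟩ := hg (g z₀) h0
  have hz₀ : z₀ ∈ K := by
    by_contra h
    exact absurd (hgK z₀ h) (not_lt.2 (le_abs_self _))
  obtain ⟨z, -, hz⟩ := hK.exists_isMaxOn ⟨z₀, hz₀⟩ hc.continuousOn
  refine ⟨z, fun u => ?_⟩
  by_cases hu : u ∈ K
  · exact hz hu
  · exact ((le_abs_self _).trans (hgK u hu).le).trans (hz hz₀)

/-- A continuous function that vanishes at the boundary and is below `M` on a closed set is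
bounded away from `M` there. -/
theorem VanishesAtBoundary.exists_lt_forall_le {g : U → ℝ} (hg : VanishesAtBoundary g)
    (hc : Continuous g) {S : Set U} (hS : IsClosed S) {M : ℝ} (hM : 0 < M)
    (h : ∀ z ∈ S, g z < M) : ∃ m < M, ∀ z ∈ S, g z ≤ m := by
  obtain ⟨K, hK, hgK⟩ := hg (M / 2) (half_pos hM)
  have key : ∃ m < M, ∀ z ∈ K ∩ S, g z ≤ m := by
    rcases (K ∩ S).eq_empty_or_nonempty with he | hne
    · exact ⟨0, hM, by simp [he]⟩
    · obtain ⟨z, hz, hmax⟩ := (hK.inter_right hS).exists_isMaxOn hne hc.continuousOn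
      exact ⟨g z, h z hz.2, fun u hu => hmax hu⟩
  obtain ⟨m, hm, hmK⟩ := key
  refine ⟨max m (M / 2), max_lt hm (half_lt_self hM), fun z hz => ?_⟩
  by_cases hzK : z ∈ K
  · exact (hmK z ⟨hzK, hz⟩).trans (le_max_left _ _)
  · exact ((le_abs_self _).trans (hgK z hzK).le).trans (le_max_right _ _)

theorem exists_mul_norm_eq_weightedNorm {f : U → ℂ} (hf : f ∈ weightedHo v)
    (h0 : 0 < weightedNorm v f) : ∃ z, v z * ‖f z‖ = weightedNorm v f := by
  have : ∃ z₀, 0 < v z₀ * ‖f z₀‖ := by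
    by_contra! h
    exact absurd (weightedNorm_le le_rfl h) (not_le.2 h0)
  obtain ⟨z₀, hz₀⟩ := this
  obtain ⟨z, hz⟩ := hf.2.exists_forall_le (weightedH_continuous_mul_norm hf.1) hz₀
  exact ⟨z, (mul_norm_le_weightedNorm hf.1 z).antisymm
    (weightedNorm_le (mul_nonneg (v.pos z).le (norm_nonneg _)) hz)⟩

/-- A bounded holomorphic function lies in `H_{v_o}` when `v` vanishes at the boundary. -/
theorem mem_weightedHo_of_bounded (hv : VanishesAtBoundary v) {f : U → ℂ} (hf : IsHolomorphic f)
    {B : ℝ} (hB : ∀ z, ‖f z‖ ≤ B) : f ∈ weightedHo v := by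
  obtain ⟨C, hC⟩ := v.bddAbove_range
  refine ⟨⟨hf, C * B, ?_⟩, fun ε hε => ?_⟩
  · rintro _ ⟨z, rfl⟩
    have hCz : v z ≤ C := hC ⟨z, rfl⟩
    exact mul_le_mul hCz (hB z) (norm_nonneg _) ((v.pos z).le.trans hCz)
  · have hB' : 0 < |B| + 1 := by positivity
    obtain ⟨K, hK, hvK⟩ := hv (ε / (|B| + 1)) (div_pos hε hB')
    refine ⟨K, hK, fun z hz => ?_⟩
    have h1 := (lt_div_iff₀ hB').1 (abs_lt.1 (hvK z hz)).2
    rw [abs_of_nonneg (mul_nonneg (v.pos z).le (norm_nonneg _))]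
    refine lt_of_le_of_lt (mul_le_mul_of_nonneg_left ?_ (v.pos z).le) h1
    linarith [hB z, le_abs_self B]

/-! ### Functionals attaining their norm at a strict peak. -/

/-- A contractive functional that attains its norm at a function peaking strictly at `x`
annihilates every function that vanishes at `x`. -/
theorem eq_zero_of_strict_peak (L : weightedHo v →ₗ[ℂ] ℂ)
    (hL : ∀ f, ‖L f‖ ≤ weightedNorm v (f : U → ℂ)) {p : weightedHo v} {x : U}
    (hpx : (p : U → ℂ) x ≠ 0)
    (hpeak : ∀ u, u ≠ x → v u * ‖(p : U → ℂ) u‖ < v x * ‖(p : U → ℂ) x‖)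
    (hLp : ‖L p‖ = v x * ‖(p : U → ℂ) x‖) {f : weightedHo v} (hfx : (f : U → ℂ) x = 0) :
    L f = 0 := by
  by_contra hne
  set M := v x * ‖(p : U → ℂ) x‖ with hMdef
  have hM : 0 < M := mul_pos (v.pos x) (norm_pos_iff.2 hpx)
  have hLf : 0 < ‖L f‖ := norm_pos_iff.2 hne
  set N : Set U := {z | v z * ‖(f : U → ℂ) z‖ < ‖L f‖ / 2} with hN
  have hNo : IsOpen N := isOpen_lt (weightedH_continuous_mul_norm f.2.1) continuous_const
  have hxN : x ∈ N := by simp [hN, hfx, hne]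
  obtain ⟨m, hm, hmN⟩ := p.2.2.exists_lt_forall_le (weightedH_continuous_mul_norm p.2.1)
    hNo.isClosed_compl hM (fun z hz => hpeak z fun h => hz (h ▸ hxN))
  set B := weightedNorm v (f : U → ℂ)
  have hB : 0 ≤ B := weightedNorm_nonneg _
  -- Small enough that adding `ε` times `f` to `p` stays below `M` off `N`, where `p` is at most
  -- `m`; the `+ 1` covers `B = 0`.
  set ε := (M - m) / (B + 1) with hεdef
  have hε : 0 < ε := div_pos (sub_pos.2 hm) (by positivity)
  have hεB : m + ε * B ≤ M := by
    have : ε * (B + 1) = M - m := div_mul_cancel₀ _ (by positivity)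
    nlinarith
  have hLp0 : L p ≠ 0 := norm_pos_iff.1 (hLp ▸ hM)
  -- The phase aligns `c * L f` with `L p`, so `L` gains the full `ε * ‖L f‖` on `p + c • f`, while
  -- the norm of `p + c • f` exceeds `M` by at most half of that.
  set c : ℂ := ε * (L p * ‖L f‖ / (M * L f)) with hc
  have hcn : ‖c‖ = ε := by
    simp only [hc, norm_mul, norm_div, Complex.norm_real, hLp, Real.norm_eq_abs, abs_norm,
      abs_of_pos hε, abs_of_pos hM]
    field_simp
  have hval : L (p + c • f) = L p * ((1 + ε * ‖L f‖ / M : ℝ) : ℂ) := by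
    have : (M : ℂ) ≠ 0 := by exact_mod_cast hM.ne'
    rw [map_add, map_smul, smul_eq_mul, hc]
    push_cast
    field_simp
  have hlow : M + ε * ‖L f‖ ≤ weightedNorm v ((p + c • f : weightedHo v) : U → ℂ) := by
    refine le_trans (le_of_eq ?_) (hL _)
    rw [hval, norm_mul, hLp, Complex.norm_real, Real.norm_of_nonneg (by positivity)]
    field_simp
  have hup : weightedNorm v ((p + c • f : weightedHo v) : U → ℂ) ≤ M + ε * (‖L f‖ / 2) := by
    refine weightedNorm_le (by positivity) fun z => ?_
    have h1 : v z * ‖((p + c • f : weightedHo v) : U → ℂ) z‖ ≤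
        v z * ‖(p : U → ℂ) z‖ + ε * (v z * ‖(f : U → ℂ) z‖) := by
      have h2 : ‖((p + c • f : weightedHo v) : U → ℂ) z‖ ≤
          ‖(p : U → ℂ) z‖ + ε * ‖(f : U → ℂ) z‖ := by
        refine (norm_add_le _ _).trans_eq ?_
        simp [hcn]
      calc _ ≤ v z * (‖(p : U → ℂ) z‖ + ε * ‖(f : U → ℂ) z‖) :=
            mul_le_mul_of_nonneg_left h2 (v.pos z).le
        _ = _ := by ring
    refine h1.trans ?_
    by_cases hz : z ∈ N
    · have h3 : v z * ‖(p : U → ℂ) z‖ ≤ M := by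
        rcases eq_or_ne z x with rfl | hzx
        · exact le_rfl
        · exact (hpeak z hzx).le
      exact add_le_add h3 (mul_le_mul_of_nonneg_left (le_of_lt hz) hε.le)
    · have h3 := hmN z hz
      have h4 := mul_le_mul_of_nonneg_left (mul_norm_le_weightedNorm f.2.1 z) hε.le
      have h5 : 0 ≤ ε * (‖L f‖ / 2) := by positivity
      linarith
  nlinarith

/-- A contractive functional that attains its norm at a function peaking strictly at `x` is a
multiple of the evaluation at `x`. -/
theorem eq_eval_of_strict_peak (L : weightedHo v →ₗ[ℂ] ℂ)
    (hL : ∀ f, ‖L f‖ ≤ weightedNorm v (f : U → ℂ)) {p : weightedHo v} {x : U}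
    (hpx : (p : U → ℂ) x ≠ 0)
    (hpeak : ∀ u, u ≠ x → v u * ‖(p : U → ℂ) u‖ < v x * ‖(p : U → ℂ) x‖)
    (hLp : ‖L p‖ = v x * ‖(p : U → ℂ) x‖) (f : weightedHo v) :
    L f = L p / (p : U → ℂ) x * (f : U → ℂ) x := by
  have h := eq_zero_of_strict_peak L hL hpx hpeak hLp
    (f := f - ((f : U → ℂ) x / (p : U → ℂ) x) • p) (by simp [hpx])
  rw [map_sub, map_smul, sub_eq_zero, smul_eq_mul] at h
  rw [h]
  ring

end Weighted

/-! ### Uniqueness, division and growth of holomorphic functions. -/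

/-- A discrete subset of a second countable space is countable. The accumulation point lies in `Z`
itself, hence inside the domain when the identity theorem is applied. -/
theorem exists_accPt_of_not_countable {X : Type*} [TopologicalSpace X]
    [SecondCountableTopology X] {Z : Set X} (hZ : ¬ Z.Countable) : ∃ p ∈ Z, AccPt p (𝓟 Z) := by
  by_contra! h
  refine hZ (IsLindelof.countable_of_isDiscrete (HereditarilyLindelofSpace.isLindelof Z) ?_)
  rw [isDiscrete_iff_nhdsNE]
  intro p hp
  have := h p hp
  rwa [AccPt, Filter.not_neBot] at this

/-- Holomorphic functions on a preconnected open set that agree on a set accumulating in it agree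
everywhere. -/
theorem DifferentiableOn.eqOn_of_accPt {V Z : Set ℂ} (hVo : IsOpen V) (hV : IsPreconnected V)
    {F G : ℂ → ℂ} (hF : DifferentiableOn ℂ F V) (hG : DifferentiableOn ℂ G V) {p : ℂ}
    (hpV : p ∈ V) (hp : AccPt p (𝓟 Z)) (h : EqOn F G Z) : EqOn F G V :=
  (hF.analyticOnNhd hVo).eqOn_of_preconnected_of_frequently_eq (hG.analyticOnNhd hVo) hV hpV
    ((accPt_iff_frequently_nhdsNE.1 hp).mono fun _ hz => h hz)

/-- A holomorphic function dominated by another one is a holomorphic multiple of it. -/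
theorem exists_holomorphic_quotient {V : Set ℂ} (hVo : IsOpen V) (hV : IsPreconnected V)
    {g h : ℂ → ℂ} (hg : DifferentiableOn ℂ g V) (hh : DifferentiableOn ℂ h V)
    (hgh : ∀ z ∈ V, ‖g z‖ ≤ ‖h z‖) {z₀ : ℂ} (hz₀ : z₀ ∈ V) (hhz₀ : h z₀ ≠ 0) :
    ∃ φ : ℂ → ℂ, DifferentiableOn ℂ φ V ∧ (∀ z ∈ V, g z = h z * φ z) ∧ ∀ z ∈ V, ‖φ z‖ ≤ 1 := by
  have hne : ∀ p ∈ V, ∀ᶠ z in 𝓝[≠] p, h z ≠ 0 := fun p hp =>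
    ((hh.analyticOnNhd hVo) p hp).eventually_eq_zero_or_eventually_ne_zero.resolve_left fun h0 =>
      hhz₀ ((hh.analyticOnNhd hVo).eqOn_zero_of_preconnected_of_eventuallyEq_zero hV hp h0 hz₀)
  -- The punctured limit gives the right value also at zeros of `h`; these are isolated, and the
  -- quotient is bounded by 1 near them, so they are removable singularities.
  set φ : ℂ → ℂ := fun z => limUnder (𝓝[≠] z) fun u => g u / h u with hφ
  have hφ_eq : ∀ z ∈ V, h z ≠ 0 → φ z = g z / h z := fun z hz h0 => by
    have hc : ContinuousAt (fun u => g u / h u) z :=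
      (hg.differentiableAt (hVo.mem_nhds hz)).continuousAt.div
        (hh.differentiableAt (hVo.mem_nhds hz)).continuousAt h0
    exact (hc.tendsto.mono_left nhdsWithin_le_nhds).limUnder_eq
  have hdiff : DifferentiableOn ℂ φ V := fun p hp => by
    obtain ⟨s, hs, hso, hps⟩ := eventually_nhds_iff.1
      ((eventually_nhdsWithin_iff.1 (hne p hp)).and (hVo.mem_nhds hp))
    have hd : DifferentiableOn ℂ (fun u => g u / h u) (s \ {p}) :=
      (hg.mono fun z hz => (hs z hz.1).2).div (hh.mono fun z hz => (hs z hz.1).2)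
        fun z hz => (hs z hz.1).1 hz.2
    have hb : BddAbove (norm ∘ (fun u => g u / h u) '' (s \ {p})) := by
      refine ⟨1, ?_⟩
      rintro _ ⟨z, hz, rfl⟩
      simp only [Function.comp, norm_div]
      exact div_le_one_of_le₀ (hgh z (hs z hz.1).2) (norm_nonneg _)
    have hu := Complex.differentiableOn_update_limUnder_of_bddAbove (hso.mem_nhds hps) hd hb
    have hcongr : DifferentiableOn ℂ φ s := hu.congr fun z hz => by
      rcases eq_or_ne z p with rfl | hzp
      · simp [hφ]
      · rw [Function.update_of_ne hzp, hφ_eq z (hs z hz).2 ((hs z hz).1 hzp)]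
    exact (hcongr.differentiableAt (hso.mem_nhds hps)).differentiableWithinAt
  have hbound : ∀ z ∈ V, h z ≠ 0 → ‖φ z‖ ≤ 1 := fun z hz h0 => by
    rw [hφ_eq z hz h0, norm_div]
    exact div_le_one_of_le₀ (hgh z hz) (norm_nonneg _)
  refine ⟨φ, hdiff, fun z hz => ?_, fun z hz => ?_⟩
  · by_cases h0 : h z = 0
    · have := hgh z hz
      rw [h0, norm_zero, norm_le_zero_iff] at this
      rw [h0, this, zero_mul]
    · rw [hφ_eq z hz h0, mul_div_cancel₀ _ h0]
  · have ht : Tendsto (fun u => ‖φ u‖) (𝓝[≠] z) (𝓝 ‖φ z‖) :=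
      ((hdiff.differentiableAt (hVo.mem_nhds hz)).continuousAt.norm.tendsto).mono_left
        nhdsWithin_le_nhds
    refine le_of_tendsto ht ?_
    filter_upwards [hne z hz, nhdsWithin_le_nhds (hVo.mem_nhds hz)] with u hu huV
    exact hbound u huV hu

/-- If `b < a`, then `a ≤ D (b / a)^n → 0`, contradicting `0 < a`. -/
theorem le_of_forall_pow_succ_le_mul_pow {a b D : ℝ} (hb : 0 ≤ b)
    (h : ∀ n : ℕ, a ^ (n + 1) ≤ D * b ^ n) : a ≤ b := by
  by_contra! hba
  have ha : 0 < a := hb.trans_lt hba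
  have ht : Tendsto (fun n : ℕ => D * (b / a) ^ n) atTop (𝓝 (D * 0)) :=
    (tendsto_pow_atTop_nhds_zero_of_lt_one (div_nonneg hb ha.le)
      ((div_lt_one ha).2 hba)).const_mul D
  rw [mul_zero] at ht
  refine absurd (ge_of_tendsto' ht fun n => ?_) (not_le.2 ha)
  rw [div_pow, ← mul_div_assoc, le_div_iff₀ (pow_pos ha n), ← pow_succ']
  exact h n

/-! ### Strict peak points of a radial weight. -/

theorem norm_lt_one_of_mem_unitDisc (z : unitDisc) : ‖(z : ℂ)‖ < 1 :=
  mem_ball_zero_iff.1 z.2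

/-- The peaking function at the point `c r` of the circle of radius `r`. -/
noncomputable def peakFun (r : ℝ) (c z : ℂ) : ℂ :=
  -- The factor `z` keeps the maximizing circle away from the origin. The linear term selects the
  -- direction `c`, the square selects the radius; the coefficient 2 is large enough to absorb the
  -- growth of the square in the imaginary direction.
  z * Complex.exp (2 * (star c * z) - (star c * z - r) ^ 2 / 2)

theorem differentiable_peakFun (r : ℝ) (c : ℂ) : Differentiable ℂ (peakFun r c) := by
  unfold peakFun
  fun_prop

theorem norm_peakFun_le {r : ℝ} {c z : ℂ} (hc : ‖c‖ = 1) (hz : ‖z‖ ≤ 1) :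
    ‖peakFun r c z‖ ≤ ‖z‖ * Real.exp (2 * ‖z‖) *
      Real.exp (-((‖z‖ - (star c * z).re) + ((star c * z).re - r) ^ 2 / 2)) := by
  have hn : ‖star c * z‖ = ‖z‖ := by rw [norm_mul, norm_star, hc, one_mul]
  rw [peakFun, norm_mul, Complex.norm_exp, mul_assoc, ← Real.exp_add]
  set y := star c * z
  refine mul_le_mul_of_nonneg_left (Real.exp_le_exp.2 ?_) (norm_nonneg _)
  have hsq : ‖z‖ ^ 2 = y.re ^ 2 + y.im ^ 2 := by
    rw [← hn, Complex.sq_norm, Complex.normSq_apply]; ring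
  have hre : y.re ≤ ‖z‖ := hn ▸ Complex.re_le_norm y
  have hval : (2 * y - (y - r) ^ 2 / 2).re = 2 * y.re - ((y.re - r) ^ 2 - y.im ^ 2) / 2 := by
    have : (y - r) ^ 2 / 2 = (y - r) * (y - r) * ((1 / 2 : ℝ) : ℂ) := by push_cast; ring
    rw [this, Complex.sub_re, Complex.re_mul_ofReal, Complex.mul_re]
    simp
    ring
  rw [hval]
  -- With `y.im ^ 2 = (‖z‖ - y.re) * (‖z‖ + y.re)` and `‖z‖ + y.re ≤ 2`, the term `y.im ^ 2 / 2`
  -- costs at most `‖z‖ - y.re`, half of what the linear term provides.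
  nlinarith [mul_nonneg (sub_nonneg.2 hre) (by linarith : 0 ≤ 2 - ‖z‖ - y.re)]

theorem norm_peakFun_self {r : ℝ} (hr : 0 ≤ r) {c : ℂ} (hc : ‖c‖ = 1) :
    ‖peakFun r c (c * r)‖ = r * Real.exp (2 * r) := by
  have h : star c * (c * r) = r := by
    rw [← mul_assoc, ← starRingEnd_apply, Complex.conj_mul', hc]; simp
  rw [peakFun, h, norm_mul, norm_mul, hc, Complex.norm_exp]
  simp [abs_of_nonneg hr]

/-- A radial weight that vanishes at the boundary has a circle all of whose points are strict peak
points of `H_{v_o}`. -/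
theorem exists_peak_circle {v : Weight unitDisc} (hr : v.IsRadial) (h0 : VanishesAtBoundary v) :
    ∃ r : ℝ, 0 < r ∧ r < 1 ∧ ∀ c : ℂ, ‖c‖ = 1 → ∃ p : weightedHo v, ∃ x : unitDisc,
      (x : ℂ) = c * r ∧ (p : unitDisc → ℂ) x ≠ 0 ∧
      ∀ u, u ≠ x → v u * ‖(p : unitDisc → ℂ) u‖ < v x * ‖(p : unitDisc → ℂ) x‖ := by
  -- This radial majorant of every weighted peak function is attained at the peak point; `r` is the
  -- modulus of a maximizer.
  set g : unitDisc → ℝ := fun z => v z * (‖(z : ℂ)‖ * Real.exp (2 * ‖(z : ℂ)‖)) with hg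
  have hgc : Continuous g := by
    have := v.continuous_toFun
    fun_prop
  have hB : ∀ z : unitDisc, ‖(z : ℂ)‖ * Real.exp (2 * ‖(z : ℂ)‖) ≤ Real.exp 2 := fun z => by
    have hz := (norm_lt_one_of_mem_unitDisc z).le
    calc _ ≤ 1 * Real.exp 2 := by gcongr; linarith
      _ = _ := one_mul _
  have hgv : VanishesAtBoundary g := fun ε hε => by
    obtain ⟨K, hK, hvK⟩ := h0 (ε / Real.exp 2) (by positivity)
    refine ⟨K, hK, fun z hz => ?_⟩
    have h1 := (lt_div_iff₀ (Real.exp_pos 2)).1 ((le_abs_self _).trans_lt (hvK z hz))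
    rw [abs_of_nonneg (mul_nonneg (v.pos z).le (by positivity))]
    exact (mul_le_mul_of_nonneg_left (hB z) (v.pos z).le).trans_lt h1
  have hhalf : (1 / 2 : ℂ) ∈ unitDisc := by
    change (1 / 2 : ℂ) ∈ Metric.ball 0 1
    rw [mem_ball_zero_iff]; norm_num
  have hpos : 0 < g ⟨1 / 2, hhalf⟩ := mul_pos (v.pos _) (by simp; positivity)
  obtain ⟨z₀, hz₀⟩ := hgv.exists_forall_le hgc hpos
  have hM : 0 < g z₀ := hpos.trans_le (hz₀ _)
  have hr0 : 0 < ‖(z₀ : ℂ)‖ := by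
    refine (norm_nonneg _).lt_of_ne fun h => hM.ne' ?_
    simp [hg, ← h]
  have hr1 := norm_lt_one_of_mem_unitDisc z₀
  refine ⟨‖(z₀ : ℂ)‖, hr0, hr1, fun c hc => ?_⟩
  set r := ‖(z₀ : ℂ)‖ with hrdef
  have hxd : c * (r : ℂ) ∈ unitDisc := by
    change c * (r : ℂ) ∈ Metric.ball 0 1
    rw [mem_ball_zero_iff, norm_mul, hc, one_mul, Complex.norm_real, Real.norm_of_nonneg hr0.le]
    exact hr1
  have hvx : v ⟨c * r, hxd⟩ = v z₀ := by
    refine hr (c * r / z₀) z₀ ⟨c * r, hxd⟩ ?_ ?_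
    · rw [norm_div, norm_mul, hc, one_mul, Complex.norm_real, Real.norm_of_nonneg hr0.le,
        div_self hr0.ne']
    · exact (div_mul_cancel₀ _ (norm_pos_iff.1 hr0)).symm
  have hpm : (fun z : unitDisc => peakFun r c z) ∈ weightedHo v := by
    refine mem_weightedHo_of_bounded h0
      ⟨peakFun r c, (differentiable_peakFun r c).differentiableOn, fun _ => rfl⟩
      (B := Real.exp 2) fun z => ?_
    have hz := (norm_lt_one_of_mem_unitDisc z).le
    refine (norm_peakFun_le hc hz).trans ?_
    have hre : (star c * (z : ℂ)).re ≤ ‖(z : ℂ)‖ := by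
      refine (Complex.re_le_norm _).trans_eq ?_
      rw [norm_mul, norm_star, hc, one_mul]
    have h1 : Real.exp (-((‖(z : ℂ)‖ - (star c * (z : ℂ)).re) +
        ((star c * (z : ℂ)).re - r) ^ 2 / 2)) ≤ 1 := by
      rw [Real.exp_le_one_iff]
      nlinarith [sq_nonneg ((star c * (z : ℂ)).re - r)]
    calc _ ≤ Real.exp 2 * 1 := mul_le_mul (hB z) h1 (Real.exp_pos _).le (Real.exp_pos _).le
      _ = _ := mul_one _
  have hpx : v ⟨c * r, hxd⟩ * ‖peakFun r c (c * r)‖ = g z₀ := by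
    rw [norm_peakFun_self hr0.le hc, hvx]
  refine ⟨⟨_, hpm⟩, ⟨c * r, hxd⟩, rfl, fun h => ?_, fun u hu => ?_⟩
  · change peakFun r c (c * r) = 0 at h
    rw [h, norm_zero, mul_zero] at hpx
    exact hM.ne hpx
  · change v u * ‖peakFun r c u‖ < v ⟨c * r, hxd⟩ * ‖peakFun r c (c * r)‖
    rw [hpx]
    set y := star c * (u : ℂ) with hy
    have hn : ‖y‖ = ‖(u : ℂ)‖ := by rw [hy, norm_mul, norm_star, hc, one_mul]
    have hre : y.re ≤ ‖(u : ℂ)‖ := hn ▸ Complex.re_le_norm y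
    -- Both terms are nonnegative, and they vanish together only when `y = r`, that is `u = c * r`.
    have hexp : 0 < ‖(u : ℂ)‖ - y.re + (y.re - r) ^ 2 / 2 := by
      by_contra! hle
      have h1 : y.re = r := by nlinarith [sq_nonneg (y.re - r)]
      have h2 : ‖y‖ = r := by
        rw [hn]
        rw [h1] at hle hre
        nlinarith
      have h3 : y.im = 0 := by
        have := Complex.sq_norm y
        rw [Complex.normSq_apply, h2, h1] at this
        nlinarith
      have h4 : y = r := Complex.ext (by simpa using h1) (by simpa using h3)
      refine hu (Subtype.ext ?_)
      change (u : ℂ) = c * r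
      rw [← h4, hy, ← mul_assoc, ← starRingEnd_apply, Complex.mul_conj', hc]
      simp
    calc v u * ‖peakFun r c u‖
        ≤ v u * (‖(u : ℂ)‖ * Real.exp (2 * ‖(u : ℂ)‖) *
          Real.exp (-((‖(u : ℂ)‖ - y.re) + (y.re - r) ^ 2 / 2))) :=
          mul_le_mul_of_nonneg_left
            (norm_peakFun_le hc (norm_lt_one_of_mem_unitDisc u).le) (v.pos u).le
      _ = g u * Real.exp (-((‖(u : ℂ)‖ - y.re) + (y.re - r) ^ 2 / 2)) := by rw [hg]; ring
      _ ≤ g z₀ * Real.exp (-((‖(u : ℂ)‖ - y.re) + (y.re - r) ^ 2 / 2)) :=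
          mul_le_mul_of_nonneg_right (hz₀ u) (Real.exp_pos _).le
      _ < g z₀ * 1 := mul_lt_mul_of_pos_left (Real.exp_lt_one_iff.2 (neg_neg_of_pos hexp)) hM
      _ = g z₀ := mul_one _

/-! ### From peak points to a weighted composition operator. -/

/-- At a point where the image of a strictly peaking function attains its norm, a linear isometry
is a multiple of the evaluation at the peak point. -/
theorem exists_eval_of_strict_peak {U V : Opens ℂ} {v : Weight U} {w : Weight V}
    (T : weightedHo v →ₗ[ℂ] weightedHo w)
    (hT : ∀ f : weightedHo v, weightedNorm w (T f : V → ℂ) = weightedNorm v (f : U → ℂ))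
    {p : weightedHo v} {x : U} (hpx : (p : U → ℂ) x ≠ 0)
    (hpeak : ∀ u, u ≠ x → v u * ‖(p : U → ℂ) u‖ < v x * ‖(p : U → ℂ) x‖) :
    ∃ z : V, ∃ k : ℂ, k ≠ 0 ∧ ∀ f : weightedHo v, (T f : V → ℂ) z = k * (f : U → ℂ) x := by
  have hM : 0 < v x * ‖(p : U → ℂ) x‖ := mul_pos (v.pos x) (norm_pos_iff.2 hpx)
  have hnorm : weightedNorm v (p : U → ℂ) = v x * ‖(p : U → ℂ) x‖ := by
    refine (weightedNorm_le hM.le fun u => ?_).antisymm (mul_norm_le_weightedNorm p.2.1 x)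
    rcases eq_or_ne u x with rfl | hu
    · exact le_rfl
    · exact (hpeak u hu).le
  obtain ⟨z, hz⟩ := exists_mul_norm_eq_weightedNorm (T p).2 (by rwa [hT, hnorm])
  rw [hT, hnorm] at hz
  -- The factor `w z` makes evaluation at `z` contractive for the weighted norm.
  let L : weightedHo v →ₗ[ℂ] ℂ :=
    (w z : ℂ) • ((LinearMap.proj z).comp ((weightedHo w).subtype.comp T))
  have hL : ∀ f, L f = w z * (T f : V → ℂ) z := fun f => rfl
  have hLn : ∀ f, ‖L f‖ = w z * ‖(T f : V → ℂ) z‖ := fun f => by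
    rw [hL, norm_mul, Complex.norm_real, Real.norm_of_nonneg (w.pos z).le]
  have hLp : ‖L p‖ = v x * ‖(p : U → ℂ) x‖ := by rw [hLn, hz]
  have hw : (w z : ℂ) ≠ 0 := Complex.ofReal_ne_zero.2 (w.pos z).ne'
  refine ⟨z, L p / (p : U → ℂ) x / w z,
    div_ne_zero (div_ne_zero (norm_pos_iff.1 (hLp ▸ hM)) hpx) hw, fun f => ?_⟩
  have h := eq_eval_of_strict_peak L
    (fun f => by rw [hLn, ← hT]; exact mul_norm_le_weightedNorm (T f).2.1 z) hpx hpeak hLp f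
  rw [hL f] at h
  rw [div_mul_eq_mul_div, ← h, mul_div_cancel_left₀ _ hw]

theorem theorem2p2 (V : Opens ℂ) (hV : IsPreconnected (V : Set ℂ))
    (v : Weight unitDisc) (w : Weight V)
    (hv_radial : v.IsRadial) (hv_zero : VanishesAtBoundary v)
    (T : weightedHo v →ₗ[ℂ] weightedHo w)
    (hT : ∀ f : weightedHo v,
      weightedNorm w (T f : V → ℂ) = weightedNorm v (f : unitDisc → ℂ)) :
    ∃ φ : V → unitDisc, ∃ h : weightedHo w,
      IsHolomorphic (fun z : V => (φ z : ℂ)) ∧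
      ∀ (f : weightedHo v) (z : V),
        (T f : V → ℂ) z = (h : V → ℂ) z * (f : unitDisc → ℂ) (φ z) := by
  obtain ⟨r, hr0, hr1, hpeak⟩ := exists_peak_circle hv_radial hv_zero
  have hmon : ∀ n : ℕ, (fun z : unitDisc => (z : ℂ) ^ n) ∈ weightedHo v := fun n =>
    mem_weightedHo_of_bounded hv_zero
      ⟨fun z => z ^ n, (differentiable_pow n).differentiableOn, fun _ => rfl⟩ (B := 1) fun z => by
        rw [norm_pow]
        exact pow_le_one₀ (norm_nonneg _) (norm_lt_one_of_mem_unitDisc z).le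
  let P : ℕ → weightedHo v := fun n => ⟨_, hmon n⟩
  have hP : ∀ n (z : unitDisc), (P n : unitDisc → ℂ) z = (z : ℂ) ^ n := fun _ _ => rfl
  choose F hFd hF using fun f : weightedHo v => (T f).2.1.1
  -- the points at which `T` acts as a multiple of an evaluation
  have hpt : ∀ t : ℝ, ∃ z : V, ∃ x : unitDisc, ∃ k : ℂ, (x : ℂ) = circleMap 0 1 t * r ∧ k ≠ 0 ∧
      ∀ f : weightedHo v, (T f : V → ℂ) z = k * (f : unitDisc → ℂ) x := fun t => by
    obtain ⟨p, x, hx, hpx, hp⟩ := hpeak (circleMap 0 1 t) (by simp)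
    obtain ⟨z, k, hk, h⟩ := exists_eval_of_strict_peak T hT hpx hp
    exact ⟨z, x, k, hx, hk, h⟩
  choose ζ ξ k hξ hk hTk using hpt
  have hh : ∀ t, F (P 0) (ζ t) = k t := fun t => by rw [hF, hTk, hP]; simp
  have hg : ∀ t, F (P 1) (ζ t) = k t * ξ t := fun t => by rw [hF, hTk, hP]; simp
  set Z : Set ℂ := range fun t => (ζ t : ℂ) with hZ
  have hZc : ¬ Z.Countable := fun hc => by
    -- The quotient recovers `circleMap 0 1 t` from `ζ t`, so countability of `Z` would make the
    -- preimage of a countable set under `circleMap`, here all of `ℝ`, countable.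
    have h1 := ((hc.image fun z => F (P 1) z / F (P 0) z / r).preimage_circleMap 0
      (one_ne_zero (α := ℝ)))
    refine Set.not_countable_univ (α := ℝ) (h1.mono fun t _ => ?_)
    refine (⟨ζ t, ⟨t, rfl⟩, ?_⟩ : circleMap 0 1 t ∈ _ '' Z)
    simp only [hh, hg, hξ]
    have := hk t
    have : (r : ℂ) ≠ 0 := by exact_mod_cast hr0.ne'
    field_simp
  obtain ⟨q, ⟨t₀, rfl⟩, hq⟩ := exists_accPt_of_not_countable hZc
  have hident : ∀ {A B : ℂ → ℂ}, DifferentiableOn ℂ A V → DifferentiableOn ℂ B V →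
      (∀ t, A (ζ t) = B (ζ t)) → EqOn A B V := fun hA hB h =>
    DifferentiableOn.eqOn_of_accPt V.isOpen hV hA hB (ζ t₀).2 hq (by rintro _ ⟨t, rfl⟩; exact h t)
  -- At `ζ t` both sides equal `(k t * ξ t) ^ (n + 1)`.
  have hpow : ∀ n, EqOn (fun z => F (P (n + 1)) z * F (P 0) z ^ n) (fun z => F (P 1) z ^ (n + 1))
      V := fun n => by
    refine hident ((hFd _).mul ((hFd _).pow n)) ((hFd _).pow _) fun t => ?_
    have : F (P (n + 1)) (ζ t) = k t * (ξ t : ℂ) ^ (n + 1) := by rw [hF, hTk, hP]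
    simp only [this, hh, hg]
    ring
  obtain ⟨C, hC⟩ := v.bddAbove_range
  have hnormP : ∀ n, weightedNorm v (P n : unitDisc → ℂ) ≤ C := fun n => by
    have hC' : ∀ z, v z ≤ C := fun z => hC ⟨z, rfl⟩
    refine weightedNorm_le ((v.pos (ξ 0)).le.trans (hC' _)) fun z => ?_
    rw [hP, norm_pow]
    calc v z * ‖(z : ℂ)‖ ^ n ≤ C * 1 := mul_le_mul (hC' z)
          (pow_le_one₀ (norm_nonneg _) (norm_lt_one_of_mem_unitDisc z).le) (by positivity)
          ((v.pos z).le.trans (hC' z))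
      _ = C := mul_one C
  have hdom : ∀ z ∈ (V : Set ℂ), ‖F (P 1) z‖ ≤ ‖F (P 0) z‖ := fun z hz => by
    refine le_of_forall_pow_succ_le_mul_pow (D := C / w ⟨z, hz⟩) (norm_nonneg _) fun n => ?_
    have hn : F (P (n + 1)) z * F (P 0) z ^ n = F (P 1) z ^ (n + 1) := hpow n hz
    rw [← norm_pow, ← norm_pow, ← hn, norm_mul]
    refine mul_le_mul_of_nonneg_right ?_ (norm_nonneg _)
    rw [le_div_iff₀ (w.pos _), mul_comm, hF _ ⟨z, hz⟩]
    exact (mul_norm_le_weightedNorm (T _).2.1 _).trans ((hT _).trans_le (hnormP _))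
  obtain ⟨φ, hφd, hφ, hφ1⟩ := exists_holomorphic_quotient V.isOpen hV (hFd _) (hFd _) hdom
    (ζ t₀).2 (by rw [hh]; exact hk t₀)
  have hφξ : ∀ t, φ (ζ t) = ξ t := fun t => by
    have := hφ (ζ t) (ζ t).2
    rw [hh, hg] at this
    exact (mul_left_cancel₀ (hk t) this).symm
  -- Modulus 1 at one point would make `‖φ‖` constantly 1, but `φ (ζ t₀) = ξ t₀` lies in the open
  -- disc.
  have hφlt : ∀ z ∈ (V : Set ℂ), ‖φ z‖ < 1 := fun z hz => by
    refine (hφ1 z hz).lt_of_ne fun h1 => ?_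
    have hmax : IsMaxOn (norm ∘ φ) V z := fun u hu => by
      simpa [h1] using hφ1 u hu
    have := Complex.norm_eqOn_of_isPreconnected_of_isMaxOn hV V.isOpen hφd hz hmax (ζ t₀).2
    simp only [Function.comp, Function.const_apply, h1, hφξ] at this
    exact (norm_lt_one_of_mem_unitDisc (ξ t₀)).ne this
  refine ⟨fun z => ⟨φ z, mem_ball_zero_iff.2 (hφlt z z.2)⟩, T (P 0), ⟨φ, hφd, fun _ => rfl⟩,
    fun f z => ?_⟩
  obtain ⟨G, hGd, hG⟩ := f.2.1.1
  have hcomp : DifferentiableOn ℂ (fun z => F (P 0) z * G (φ z)) V :=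
    (hFd _).mul (hGd.comp hφd fun z hz => mem_ball_zero_iff.2 (hφlt z hz))
  have := hident (hFd f) hcomp (fun t => by rw [hF, hTk, hh, hφξ, hG]) z.2
  simp only [hF] at this
  rw [this, ← hG]
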